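/- All digraphs are finite; a digraph is a finite (possibly empty) vertex set with an arbitrary set of arcs (ordered pairs of vertices, loops allowed), and $G\to H$ means that there is a homomorphism (arc-preserving map) from $G$ to $H$. Digraphs $H,H'$ are homomorphically equivalent if $H\to H'$ and $H'\to H$. A tree is an orientation of an undirected tree. A set $\mathcal F$ of digraphs is a complete set of obstructions for $H$ if for every digraph $G$ we have $G\to H$ if and only if no $F\in\mathcal F$ satisfies $F\to G$; a dual of a tree $T$ is a digraph for which $\{T\}$ is a complete set of obstructions. The arc graph $\delta G$ of $G=(V,A)$ has vertex set $A$ and arcs $((u,v),(v,w))$ for $(u,v),(v,w)\in A$. Products are products in the category of digraphs: there is an arc from $(x_1,\dots,x_k)$ to $(y_1,\dots,y_k)$ if and only if $(x_i,y_i)$ is an arc of the $i$-th factor for every $i$. A core of $H$ is a smallest subgraph of $H$ to which $H$ admits a homomorphism; a digraph is a core if it is a core of itself, i.e. if it admits no homomorphism to a proper subgraph of itself. A near-unanimity function on $H$ is a homomorphism $f:H^k\to H$ for some $k\ge 3$ such that for all $x,y\in V(H)$, $f(x,x,\dots,x)=f(y,x,\dots,x)=f(x,y,x,\dots,x)=\dots=f(x,\dots,x,y)=x$.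 The algebraic height of a tree $T$ is the minimum number of arcs of a directed path to which $T$ admits a homomorphism; $H$ has bounded-height tree duality if there is a constant $m$ such that $H$ has a complete set of obstructions consisting of trees of algebraic height at most $m$. **Proposition 3.1.** Let $\delta_\pi\mathcal C$ be the smallest class of digraphs that contains all duals of trees and is closed under taking arc graphs, finite products and homomorphically equivalent digraphs. Then: (i) Every core in $\delta_\pi\mathcal C$ admits a near-unanimity function. (ii) Every member of $\delta_\pi\mathcal C$ has bounded-height tree duality. (iii) The class of digraphs that admit a near-unanimity function is closed under taking cores, finite products and arc graphs. (iv) The class of digraphs that have bounded-height tree duality is closed under taking cores, finite products and arc graphs. -/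

import Mathlib

/-!
Call a homomorphism `f : H ^ k → H` a quasi near-unanimity function if `f` sends every tuple that
is constant up to one entry to the value of `f` at the constant tuple. Having one is invariant under
homomorphic equivalence and passes to products and arc graphs. A dual `D` of a tree `T` has one:
for `k` large, `T` does not map to the quotient of `D ^ k` that identifies the near-constant tuples
with the constant ones, because each arc of `T` spoils at most two coordinates of a homomorphism
and the remaining ones would map `T` to `D`; hence this quotient maps to `D`. On a core
the endomorphism `x ↦ f (x, …, x)` is invertible, so `f` can be corrected to a near-unanimity
function.

For bounded height, a tree of height at most `m` maps to `G` if and only if it maps to the product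
of `G` with the directed path `P_m`, and all trees over a digraph `X` map to `H` if and only if `X`
has arc-consistent lists with values in `H`. Hence `H` has bounded-height tree duality if and only
if, for some `m`, arc consistency of `G × P_m` with respect to `H` suffices for `G → H`. If `δ_L`
denotes the left adjoint of `δ`, then arc consistency of `X` with respect to `δ H` implies that
of `δ_L X` with respect to `H`, and `δ_L G × P_m` maps to `δ_L (G × P_{m + 1})`. So the criterion
passes from `H` with bound `m` to `δ H` with bound `m + 1`.
-/

universe u

/-- A finite digraph: a finite vertex set with an arbitrary set of arcs (ordered pairs of vertices).
Loops and the empty digraph are allowed. -/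
structure FinDigraph where
  /-- the vertices -/
  V : Type u
  /-- the arcs -/
  graph : Digraph V
  [finite : Finite V]

namespace FinDigraph

attribute [instance] FinDigraph.finite

/-- `G.Adj x y` : the pair `(x, y)` is an arc of `G`. -/
abbrev Adj (G : FinDigraph.{u}) (x y : G.V) : Prop := G.graph.Adj x y

/-- Homomorphisms of digraphs: arc-preserving maps. -/
abbrev Hom (G H : FinDigraph.{u}) : Type u := G.Adj →r H.Adj

/-- `G → H` : there exists a homomorphism from `G` to `H`. -/
def MapsTo (G H : FinDigraph.{u}) : Prop := Nonempty (Hom G H)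

/-- Homomorphic equivalence. -/
def HomEquiv (G H : FinDigraph.{u}) : Prop := G.MapsTo H ∧ H.MapsTo G

/-- The arc graph `δ G`: its vertices are the arcs of `G`, and its arcs are the pairs
`((x, y), (y, z))` of consecutive arcs of `G`. -/
def arcGraph (G : FinDigraph.{u}) : FinDigraph.{u} where
  V := {a : G.V × G.V // G.Adj a.1 a.2}
  graph := { Adj := fun a b => a.1.2 = b.1.1 }

/-- The product `H 0 × ⋯ × H (k - 1)` in the category of digraphs. -/
def prod {k : ℕ} (H : Fin k → FinDigraph.{u}) : FinDigraph.{u} where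
  V := ∀ i, (H i).V
  graph := { Adj := fun x y => ∀ i, (H i).Adj (x i) (y i) }

/-- The `k`-fold power `H × ⋯ × H`. -/
abbrev power (H : FinDigraph.{u}) (k : ℕ) : FinDigraph.{u} := prod (fun _ : Fin k => H)

/-- `H` admits a near-unanimity function: for some `k ≥ 3` there is a homomorphism
`f : H ^ k → H` such that `f (x, …, x, y, x, …, x) = x` for all vertices `x, y` and every position
of `y` (the case `y = x` is `f (x, …, x) = x`). -/
def HasNearUnanimity (H : FinDigraph.{u}) : Prop :=
  ∃ k : ℕ, 3 ≤ k ∧ ∃ f : Hom (H.power k) H,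
    ∀ (x y : H.V) (i : Fin k), f (Function.update (fun _ => x) i y) = x

/-- `T` is an (oriented) tree: its arcs orient the edges of an undirected tree, that is, there are
neither loops nor pairs of opposite arcs, and the underlying undirected graph is a tree
(in particular, it is nonempty). -/
def IsTree (T : FinDigraph.{u}) : Prop :=
  (∀ x y, T.Adj x y → ¬ T.Adj y x) ∧ T.graph.toSimpleGraphInclusive.IsTree

/-- `D` is a dual of `T`: a digraph maps to `D` if and only if `T` does not map to it. -/
def IsDual (T D : FinDigraph.{u}) : Prop :=
  ∀ G : FinDigraph.{u}, G.MapsTo D ↔ ¬ T.MapsTo G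

/-- The directed path with `n` arcs `0 → 1 → ⋯ → n`. -/
def dirPath (n : ℕ) : FinDigraph.{u} where
  V := ULift.{u} (Fin (n + 1))
  graph := { Adj := fun i j => (j.down : ℕ) = i.down + 1 }

/-- The algebraic height: the minimum number of arcs of a directed path to which `T` maps
(`⊤` if there is none, which does not happen for trees). -/
noncomputable def algHeight (T : FinDigraph.{u}) : ℕ∞ :=
  ⨅ (n : ℕ) (_ : T.MapsTo (dirPath n)), (n : ℕ∞)

/-- `F` is a complete set of obstructions for `H`. -/
def IsCompleteObstructionSet (F : Set FinDigraph.{u}) (H : FinDigraph.{u}) : Prop :=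
  ∀ G : FinDigraph.{u}, G.MapsTo H ↔ ∀ T ∈ F, ¬ T.MapsTo G

/-- `H` has bounded-height tree duality. -/
def HasBoundedHeightTreeDuality (H : FinDigraph.{u}) : Prop :=
  ∃ (m : ℕ) (F : Set FinDigraph.{u}),
    (∀ T ∈ F, T.IsTree ∧ T.algHeight ≤ (m : ℕ∞)) ∧ IsCompleteObstructionSet F H

/-- Subgraphs of `H`: a subset of the vertices, together with a subset of the arcs of `H` among
these vertices. -/
@[ext]
structure Subgraph (H : FinDigraph.{u}) where
  /-- the vertices of the subgraph -/
  verts : Set H.V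
  /-- the arcs of the subgraph -/
  arc : H.V → H.V → Prop
  arc_sub : ∀ {x y}, arc x y → H.Adj x y
  fst_mem : ∀ {x y}, arc x y → x ∈ verts
  snd_mem : ∀ {x y}, arc x y → y ∈ verts

/-- A subgraph of `H`, as a digraph on its own. -/
def Subgraph.toFinDigraph {H : FinDigraph.{u}} (S : H.Subgraph) : FinDigraph.{u} where
  V := S.verts
  graph := { Adj := fun x y => S.arc x y }

/-- Inclusion of subgraphs. -/
instance {H : FinDigraph.{u}} : LE H.Subgraph where
  le S S' := S.verts ⊆ S'.verts ∧ ∀ x y, S.arc x y → S'.arc x y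

/-- `H` as a subgraph of itself. -/
instance {H : FinDigraph.{u}} : Top H.Subgraph where
  top := { verts := Set.univ, arc := H.Adj, arc_sub := id, fst_mem := fun _ => trivial,
           snd_mem := fun _ => trivial }

/-- The subgraph `S` is a core of `H`: it is a smallest (inclusion-minimal) subgraph to
which `H` maps. -/
def Subgraph.IsCoreOf {H : FinDigraph.{u}} (S : H.Subgraph) : Prop :=
  Minimal (fun S' : H.Subgraph => H.MapsTo S'.toFinDigraph) S

/-- `H` is a core: it is a core of itself, that is, it does not map to any proper subgraph. -/
def IsCore (H : FinDigraph.{u}) : Prop := (⊤ : H.Subgraph).IsCoreOf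

/-- The class `δ_π C`: the smallest class of digraphs that contains all duals of trees and is closed
under taking arc graphs, finite products and homomorphically equivalent digraphs. -/
inductive DeltaPiC : FinDigraph.{u} → Prop
  | dual {T D : FinDigraph.{u}} : T.IsTree → IsDual T D → DeltaPiC D
  | arcGraph {H : FinDigraph.{u}} : DeltaPiC H → DeltaPiC H.arcGraph
  | prod {k : ℕ} {H : Fin k → FinDigraph.{u}} : (∀ i, DeltaPiC (H i)) → DeltaPiC (prod H)
  | homEquiv {H H' : FinDigraph.{u}} : DeltaPiC H → HomEquiv H H' → DeltaPiC H'

end FinDigraph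

namespace FinDigraph

variable {G G' H H' X S T D : FinDigraph.{u}}

theorem MapsTo.refl (G : FinDigraph.{u}) : G.MapsTo G := ⟨RelHom.id _⟩

theorem MapsTo.trans : G.MapsTo G' → G'.MapsTo H → G.MapsTo H :=
  fun ⟨f⟩ ⟨g⟩ => ⟨g.comp f⟩

theorem mapsTo_prod_iff {k : ℕ} {H : Fin k → FinDigraph.{u}} :
    G.MapsTo (prod H) ↔ ∀ i, G.MapsTo (H i) :=
  ⟨fun ⟨f⟩ i => ⟨⟨fun x => f x i, fun h => f.map_rel h i⟩⟩,
    fun h => ⟨⟨fun x i => (h i).some x, fun hxy i => (h i).some.map_rel hxy⟩⟩⟩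

/-- The action of the product functor on homomorphisms. -/
def prodMap {k : ℕ} {G H : Fin k → FinDigraph.{u}} (d : ∀ i, Hom (G i) (H i)) :
    Hom (prod G) (prod H) where
  toFun x i := d i (x i)
  map_rel' h i := (d i).map_rel (h i)

/-- The action of the arc graph functor on homomorphisms. -/
def arcGraphMap (d : Hom G H) : Hom G.arcGraph H.arcGraph where
  toFun a := ⟨(d a.1.1, d a.1.2), d.map_rel a.2⟩
  map_rel' h := congrArg d h

/-! ### Cores -/

namespace Subgraph

/-- The inclusion homomorphism of a subgraph. -/
def incl (C : H.Subgraph) : Hom C.toFinDigraph H where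
  toFun := Subtype.val
  map_rel' := C.arc_sub

/-- The image of a homomorphism. -/
def range (f : Hom G H) : H.Subgraph where
  verts := Set.range f
  arc := Relation.Map G.Adj f f
  arc_sub := by rintro _ _ ⟨a, b, h, rfl, rfl⟩; exact f.map_rel h
  fst_mem := by rintro _ _ ⟨a, _, -, rfl, _⟩; exact ⟨a, rfl⟩
  snd_mem := by rintro _ _ ⟨_, b, -, _, rfl⟩; exact ⟨b, rfl⟩

theorem mapsTo_range (f : Hom G H) : G.MapsTo (range f).toFinDigraph :=
  ⟨⟨fun x => ⟨f x, x, rfl⟩, fun {a b} h => ⟨a, b, h, rfl, rfl⟩⟩⟩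

namespace IsCoreOf

variable {C : H.Subgraph}

theorem homEquiv (hC : C.IsCoreOf) : H.HomEquiv C.toFinDigraph :=
  ⟨hC.prop, ⟨C.incl⟩⟩

theorem verts_subset_range (hC : C.IsCoreOf) (hG : H.MapsTo G) {f : Hom G H} (hf : range f ≤ C) :
    C.verts ⊆ Set.range f :=
  (hC.le_of_le (hG.trans (mapsTo_range f)) hf).1

theorem surjective (hC : C.IsCoreOf) (e : Hom C.toFinDigraph C.toFinDigraph) :
    Function.Surjective e := by
  have hle : range (C.incl.comp e) ≤ C := by
    constructor
    · rintro _ ⟨x, rfl⟩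
      exact (e x).2
    · rintro _ _ ⟨a, b, h, rfl, rfl⟩
      exact e.map_rel h
  intro y
  obtain ⟨x, hx⟩ := hC.verts_subset_range hC.prop hle y.2
  exact ⟨x, Subtype.ext hx⟩

end IsCoreOf

end Subgraph

theorem IsCore.surjective (hH : H.IsCore) (e : Hom H H) : Function.Surjective e := fun y =>
  Subgraph.IsCoreOf.verts_subset_range hH (MapsTo.refl H) (f := e)
    ⟨fun _ _ => trivial, fun _ _ => (Subgraph.range e).arc_sub⟩ (Set.mem_univ y)

theorem exists_comp_eq_id_of_surjective {e : Hom H H} (he : Function.Surjective e) :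
    ∃ g : Hom H H, g.comp e = RelHom.id H.Adj := by
  have : Finite (Hom H H) := DFunLike.finite _
  have hreg : IsRightRegular e := fun f g hfg => RelHom.ext fun x => by
    obtain ⟨y, rfl⟩ := he x
    exact DFunLike.congr_fun hfg y
  exact hreg.isUnit_of_finite.exists_left_inv

/-! ### Near-unanimity functions -/

/-- `f : G ^ k → H` is a near-unanimity function over `d : G → H`: it sends a tuple to `d x`
as soon as all its entries, except at most one, equal `x`. Near-unanimity functions on `H` are the
case where `d` is the identity of `H`. -/
def IsNearUnanimityOver {k : ℕ} (d : Hom G H) (f : Hom (G.power k) H) : Prop :=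
  ∀ (x y : G.V) (i : Fin k), f (Function.update (fun _ => x) i y) = d x

/-- There is a near-unanimity function over `d` of some arity at least `3`. -/
def HasNearUnanimityOver (d : Hom G H) : Prop :=
  ∃ k : ℕ, 3 ≤ k ∧ ∃ f : Hom (G.power k) H, IsNearUnanimityOver d f

/-- `H` admits a quasi near-unanimity function: one over some endomorphism of `H`. In contrast to
`HasNearUnanimity`, this is invariant under homomorphic equivalence. -/
def HasQuasiNearUnanimity (H : FinDigraph.{u}) : Prop :=
  ∃ d : Hom H H, HasNearUnanimityOver d

theorem IsNearUnanimityOver.apply_update {α : Type*} {d : Hom G H} {k : ℕ} {f : Hom (G.power k) H}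
    (hf : IsNearUnanimityOver d f) (p : α → G.V) (x y : α) (i : Fin k) :
    f (fun j => p (Function.update (fun _ => x) i y j)) = d (p x) :=
  (congrArg f (Function.comp_update p _ i y)).trans (hf (p x) (p y) i)

theorem IsNearUnanimityOver.exists_of_le {d : Hom G H} {k l : ℕ} {f : Hom (G.power k) H}
    (hf : IsNearUnanimityOver d f) (hk : 0 < k) (hkl : k ≤ l) :
    ∃ g : Hom (G.power l) H, IsNearUnanimityOver d g := by
  refine ⟨⟨fun x => f (x ∘ Fin.castLE hkl), fun h => f.map_rel fun j => h (Fin.castLE hkl j)⟩,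
    fun x y i => ?_⟩
  change f (Function.update (fun _ => x) i y ∘ Fin.castLE hkl) = d x
  by_cases hi : ∃ j, Fin.castLE hkl j = i
  · obtain ⟨j, rfl⟩ := hi
    rw [Function.update_comp_eq_of_injective _ (Fin.castLE_injective hkl)]
    exact hf x y j
  · rw [Function.update_comp_eq_of_forall_ne _ _ (not_exists.1 hi)]
    have hconst : f (fun _ => x) = d x := by
      simpa only [Function.update_eq_self] using hf x x ⟨0, hk⟩
    exact hconst

theorem HasNearUnanimityOver.comp {d : Hom G H} (h : HasNearUnanimityOver d) (s : Hom G' G)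
    (r : Hom H H') : HasNearUnanimityOver (r.comp (d.comp s)) := by
  obtain ⟨k, hk, f, hf⟩ := h
  exact ⟨k, hk, r.comp (f.comp (prodMap fun _ => s)),
    fun x y i => congrArg r (hf.apply_update s x y i)⟩

theorem HasNearUnanimityOver.prod {n : ℕ} {G H : Fin n → FinDigraph.{u}}
    {d : ∀ i, Hom (G i) (H i)} (h : ∀ i, HasNearUnanimityOver (d i)) :
    HasNearUnanimityOver (prodMap d) := by
  choose a ha f hf using h
  let k := max 3 (Finset.univ.sup a)
  have hk : ∀ i, a i ≤ k := fun i => (Finset.le_sup (Finset.mem_univ i)).trans (le_max_right _ _)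
  choose g hg using fun i => (hf i).exists_of_le (by have := ha i; omega) (hk i)
  refine ⟨k, le_max_left _ _, ⟨fun x i => g i fun j => x j i,
    fun h i => (g i).map_rel fun j => h j i⟩, fun x y j => funext fun i => ?_⟩
  exact (hg i).apply_update (fun x => x i) x y j

theorem HasNearUnanimityOver.arcGraph {d : Hom G H} (h : HasNearUnanimityOver d) :
    HasNearUnanimityOver (arcGraphMap d) := by
  obtain ⟨k, hk, f, hf⟩ := h
  refine ⟨k, hk, ⟨fun x => ⟨(f fun i => (x i).1.1, f fun i => (x i).1.2),
    f.map_rel fun i => (x i).2⟩, fun h => congrArg f (funext h)⟩, fun x y i => ?_⟩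
  refine Subtype.ext (Prod.ext ?_ ?_)
  · exact hf.apply_update (fun a => a.1.1) x y i
  · exact hf.apply_update (fun a => a.1.2) x y i

theorem HasNearUnanimityOver.hasNearUnanimity_of_surjective {e : Hom H H}
    (h : HasNearUnanimityOver e) (he : Function.Surjective e) : H.HasNearUnanimity := by
  obtain ⟨g, hg⟩ := exists_comp_eq_id_of_surjective he
  have hid : HasNearUnanimityOver (g.comp e) := h.comp (RelHom.id _) g
  rwa [hg] at hid

namespace HasQuasiNearUnanimity

theorem of_homEquiv (he : H.HomEquiv H') : H.HasQuasiNearUnanimity → H'.HasQuasiNearUnanimity := by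
  obtain ⟨⟨r⟩, ⟨s⟩⟩ := he
  exact fun ⟨_, hd⟩ => ⟨_, hd.comp s r⟩

theorem prod {k : ℕ} {H : Fin k → FinDigraph.{u}} (h : ∀ i, (H i).HasQuasiNearUnanimity) :
    (FinDigraph.prod H).HasQuasiNearUnanimity := by
  choose d hd using h
  exact ⟨prodMap d, .prod hd⟩

theorem arcGraph : H.HasQuasiNearUnanimity → H.arcGraph.HasQuasiNearUnanimity :=
  fun ⟨d, hd⟩ => ⟨arcGraphMap d, hd.arcGraph⟩

end HasQuasiNearUnanimity

namespace HasNearUnanimity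

theorem hasQuasiNearUnanimity (h : H.HasNearUnanimity) : H.HasQuasiNearUnanimity :=
  ⟨RelHom.id _, h⟩

theorem core {C : H.Subgraph} (hC : C.IsCoreOf) (h : H.HasNearUnanimity) :
    C.toFinDigraph.HasNearUnanimity := by
  obtain ⟨e, he⟩ := h.hasQuasiNearUnanimity.of_homEquiv hC.homEquiv
  exact he.hasNearUnanimity_of_surjective (hC.surjective e)

theorem prod {k : ℕ} {H : Fin k → FinDigraph.{u}} (h : ∀ i, (H i).HasNearUnanimity) :
    (FinDigraph.prod H).HasNearUnanimity :=
  HasNearUnanimityOver.prod (d := fun _ => RelHom.id _) h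

theorem arcGraph (h : H.HasNearUnanimity) : H.arcGraph.HasNearUnanimity :=
  HasNearUnanimityOver.arcGraph (d := RelHom.id _) h

end HasNearUnanimity

/-! ### Quasi near-unanimity functions on duals -/

open Classical in
/-- Replaces each tuple that is constant up to one coordinate by the constant tuple, and leaves
the other tuples unchanged. The constant is well defined only for tuples of length at least `3`. -/
noncomputable def majority {α : Type*} {k : ℕ} (x : Fin k → α) : Fin k → α :=
  if h : ∃ a b i, x = Function.update (fun _ => a) i b then fun _ => h.choose else x

theorem exists_forall_ne_majority_eq {α : Type*} {k : ℕ} (hk : 0 < k) (x : Fin k → α) :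
    ∃ i, ∀ j ≠ i, majority x j = x j := by
  unfold majority
  split_ifs with h
  · obtain ⟨b, i, hx⟩ := h.choose_spec
    refine ⟨i, fun j hj => ?_⟩
    rw [congrFun hx j, Function.update_of_ne hj]
  · exact ⟨⟨0, hk⟩, fun _ _ => rfl⟩

theorem majority_update {α : Type*} {k : ℕ} (hk : 3 ≤ k) (a b : α) (i : Fin k) :
    majority (Function.update (fun _ => a) i b) = fun _ => a := by
  have h : ∃ a' b' i', Function.update (fun _ => a) i b = Function.update (fun _ => a') i' b' :=
    ⟨a, b, i, rfl⟩
  obtain ⟨b', i', hx⟩ := h.choose_spec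
  obtain ⟨j, hji, hji'⟩ := Fin.exists_ne_and_ne_of_two_lt i i' hk
  have hj := congrFun hx j
  rw [Function.update_of_ne hji, Function.update_of_ne hji'] at hj
  rw [majority, dif_pos h, ← hj]

theorem majority_const {α : Type*} {k : ℕ} (hk : 3 ≤ k) (a : α) :
    majority (fun _ : Fin k => a) = fun _ => a := by
  simpa only [Function.update_eq_self] using majority_update hk a a ⟨0, by omega⟩

/-- The quotient of `D ^ k` that identifies the near-constant tuples with the constant ones, carried
by the tuples (those not fixed by `majority` are isolated vertices). -/
noncomputable def majorityQuotient (D : FinDigraph.{u}) (k : ℕ) : FinDigraph.{u} where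
  V := Fin k → D.V
  graph := { Adj := Relation.Map (D.power k).Adj majority majority }

theorem exists_adj_of_majorityQuotient_adj {k : ℕ} {a b : Fin k → D.V}
    (h : (D.majorityQuotient k).Adj a b) (hk : 0 < k) :
    ∃ i i', ∀ j, j ≠ i → j ≠ i' → D.Adj (a j) (b j) := by
  obtain ⟨x, y, hxy, rfl, rfl⟩ := h
  obtain ⟨i, hi⟩ := exists_forall_ne_majority_eq hk x
  obtain ⟨i', hi'⟩ := exists_forall_ne_majority_eq hk y
  refine ⟨i, i', fun j hj hj' => ?_⟩
  rw [hi j hj, hi' j hj']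
  exact hxy j

/-- Each arc of `T` spoils at most two coordinates, so some coordinate projection is a
homomorphism. -/
theorem MapsTo.of_majorityQuotient {k : ℕ} (h : T.MapsTo (D.majorityQuotient k))
    (hk : 2 * Nat.card T.arcGraph.V < k) : T.MapsTo D := by
  obtain ⟨φ⟩ := h
  choose b c hbc using fun a : T.arcGraph.V =>
    exists_adj_of_majorityQuotient_adj (φ.map_rel a.2) (by omega)
  obtain ⟨j, hj⟩ : ∃ j, ∀ a, Sum.elim b c a ≠ j := by
    by_contra! hsurj
    have hcard := Nat.card_le_card_of_surjective _ hsurj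
    rw [Nat.card_sum, Nat.card_fin] at hcard
    omega
  exact ⟨fun t => φ t j,
    fun {s t} h => hbc ⟨(s, t), h⟩ j (hj (.inl _)).symm (hj (.inr _)).symm⟩

theorem IsDual.hasQuasiNearUnanimity (h : IsDual T D) : D.HasQuasiNearUnanimity := by
  let k := 2 * Nat.card T.arcGraph.V + 3
  have hk : 3 ≤ k := Nat.le_add_left _ _
  have hTQ : ¬ T.MapsTo (D.majorityQuotient k) := fun hT =>
    (h D).1 (.refl D) (hT.of_majorityQuotient (by omega))
  obtain ⟨f⟩ := (h _).2 hTQ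
  let q : Hom (D.power k) (D.majorityQuotient k) := ⟨majority, fun hxy => ⟨_, _, hxy, rfl, rfl⟩⟩
  let diag : Hom D (D.power k) := ⟨fun x _ => x, fun hxy _ => hxy⟩
  refine ⟨(f.comp q).comp diag, k, hk, f.comp q, fun x y i => congrArg f ?_⟩
  exact (majority_update hk x y i).trans (majority_const hk x).symm

theorem DeltaPiC.hasQuasiNearUnanimity (h : H.DeltaPiC) : H.HasQuasiNearUnanimity := by
  induction h with
  | dual _ hD => exact hD.hasQuasiNearUnanimity
  | arcGraph _ ih => exact ih.arcGraph
  | prod _ ih => exact .prod ih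
  | homEquiv _ he ih => exact ih.of_homEquiv he

/-! ### Arc consistency -/

/-- The lists `L x` of candidate images form an arc-consistent system for the relational
homomorphisms from `r` to `s`. -/
structure IsArcConsistent {α β : Type*} (r : α → α → Prop) (s : β → β → Prop) (L : α → Set β) :
    Prop where
  nonempty (x : α) : (L x).Nonempty
  forward {x y : α} : r x y → ∀ a ∈ L x, ∃ b ∈ L y, s a b
  backward {x y : α} : r x y → ∀ b ∈ L y, ∃ a ∈ L x, s a b

/-- Some system of lists is arc-consistent, that is, the arc-consistency check does not refute
`X → H`. -/
def ArcConsistent (X H : FinDigraph.{u}) : Prop :=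
  ∃ L : X.V → Set H.V, IsArcConsistent X.Adj H.Adj L

theorem ArcConsistent.of_mapsTo (h : G'.ArcConsistent H) : G.MapsTo G' → G.ArcConsistent H := by
  obtain ⟨L, hL⟩ := h
  exact fun ⟨f⟩ => ⟨L ∘ f, fun x => hL.nonempty (f x), fun hxy => hL.forward (f.map_rel hxy),
    fun hxy => hL.backward (f.map_rel hxy)⟩

/-- The value at `v` is obtained by extending along the unique path from a fixed root to `v`. -/
theorem exists_section_of_isTree {V : Type*} {G : SimpleGraph V} (hG : G.IsTree)
    {Y : V → Type*} [∀ v, Nonempty (Y v)] {R : ∀ u v, Y u → Y v → Prop}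
    (symm : ∀ {u v a b}, R u v a b → R v u b a)
    (extend : ∀ u v, G.Adj u v → ∀ a, ∃ b, R u v a b) :
    ∃ ψ : ∀ v, Y v, ∀ u v, G.Adj u v → R u v (ψ u) (ψ v) := by
  obtain ⟨r⟩ := hG.connected.nonempty
  choose e he using extend
  choose path hpath using fun v => (hG.existsUnique_path r v).exists
  let transport {u v : V} (p : G.Walk u v) : Y u → Y v :=
    SimpleGraph.Walk.concatRec (motive := fun u v _ => Y u → Y v) id
      (fun _ h t a => e _ _ h (t a)) p
  let ψ (v : V) : Y v := transport (path v) (Classical.arbitrary _)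
  have step : ∀ {u v}, G.Adj u v → u ∈ (path v).support → R u v (ψ u) (ψ v) := by
    intro u v h hu
    have hv : ψ v = e u v h (ψ u) := by
      simp only [ψ, transport, hG.isAcyclic.path_concat (hpath u) (hpath v) h hu,
        SimpleGraph.Walk.concatRec_concat]
    exact hv ▸ he u v h (ψ u)
  refine ⟨ψ, fun u v h => ?_⟩
  by_cases hu : u ∈ (path v).support
  · exact step h hu
  · exact symm (step h.symm
      (hG.isAcyclic.mem_support_of_ne_mem_support_of_adj_of_isPath (hpath u) (hpath v) h hu))

theorem IsTree.toSimpleGraphInclusive_adj (hT : T.IsTree) {x y : T.V} (h : T.Adj x y) :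
    T.graph.toSimpleGraphInclusive.Adj x y :=
  ⟨by rintro rfl; exact hT.1 _ _ h h, Or.inl h⟩

theorem IsArcConsistent.nonempty_relHom {β : Type*} {s : β → β → Prop} {L : T.V → Set β}
    (hL : IsArcConsistent T.Adj s L) (hT : T.IsTree) : Nonempty (T.Adj →r s) := by
  have : ∀ x, Nonempty (L x) := fun x => (hL.nonempty x).to_subtype
  obtain ⟨ψ, hψ⟩ := exists_section_of_isTree hT.2 (Y := fun x => L x)
    (R := fun x y a b => (T.Adj x y → s a b) ∧ (T.Adj y x → s b a)) And.symm (by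
      rintro x y ⟨-, hxy | hyx⟩ ⟨a, ha⟩
      · obtain ⟨b, hb, hab⟩ := hL.forward hxy a ha
        exact ⟨⟨b, hb⟩, fun _ => hab, fun hyx => absurd hyx (hT.1 _ _ hxy)⟩
      · obtain ⟨b, hb, hba⟩ := hL.backward hyx a ha
        exact ⟨⟨b, hb⟩, fun hxy => absurd hxy (hT.1 _ _ hyx), fun _ => hba⟩)
  exact ⟨⟨fun x => ψ x, fun {x y} h => (hψ x y (hT.toSimpleGraphInclusive_adj h)).1 h⟩⟩

theorem IsTree.mapsTo_of_arcConsistent (hT : T.IsTree) (h : T.ArcConsistent H) : T.MapsTo H := by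
  obtain ⟨L, hL⟩ := h
  exact hL.nonempty_relHom hT

/-! ### Algebraic height -/

theorem dirPath_mapsTo_dirPath {n m : ℕ} (h : n ≤ m) : (dirPath.{u} n).MapsTo (dirPath m) :=
  ⟨⟨fun i => ⟨Fin.castLE (by omega) i.down⟩, fun h => h⟩⟩

theorem algHeight_le_iff {m : ℕ} : T.algHeight ≤ m ↔ T.MapsTo (dirPath m) := by
  refine ⟨fun h => ?_, fun h => iInf₂_le m h⟩
  have hlt : T.algHeight < (m + 1 : ℕ) := h.trans_lt (Nat.cast_lt.2 m.lt_succ_self)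
  simp only [algHeight, iInf_lt_iff, Nat.cast_lt] at hlt
  obtain ⟨n, hn, hnm⟩ := hlt
  exact hn.trans (dirPath_mapsTo_dirPath (Nat.lt_succ_iff.1 hnm))

theorem mapsTo_dirPath_of_relHom (ℓ : T.Adj →r fun a b : ℤ => b = a + 1) :
    ∃ m : ℕ, T.MapsTo (dirPath m) := by
  obtain ⟨M, hM⟩ := (Set.finite_range ℓ).bddAbove
  obtain ⟨B, hB⟩ := (Set.finite_range ℓ).bddBelow
  have hM : ∀ t, ℓ t ≤ M := fun t => hM ⟨t, rfl⟩
  have hB : ∀ t, B ≤ ℓ t := fun t => hB ⟨t, rfl⟩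
  refine ⟨(M - B).toNat, ⟨⟨fun t => ⟨⟨(ℓ t - B).toNat, ?_⟩⟩, fun {s t} h => ?_⟩⟩⟩
  · have := hM t
    omega
  · have := ℓ.map_rel h
    have := hB s
    change (ℓ t - B).toNat = (ℓ s - B).toNat + 1
    omega

theorem IsTree.exists_mapsTo_dirPath (hT : T.IsTree) : ∃ m : ℕ, T.MapsTo (dirPath m) := by
  have hL : IsArcConsistent T.Adj (fun a b : ℤ => b = a + 1) fun _ => Set.univ :=
    ⟨fun _ => Set.univ_nonempty, fun _ a _ => ⟨a + 1, trivial, rfl⟩,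
      fun _ b _ => ⟨b - 1, trivial, by omega⟩⟩
  obtain ⟨ℓ⟩ := hL.nonempty_relHom hT
  exact mapsTo_dirPath_of_relHom ℓ

/-! ### Gluing trees -/

/-- The digraph with one vertex and no arc. -/
def point : FinDigraph.{u} where
  V := PUnit
  graph := { Adj := fun _ _ => False }

theorem isTree_point : point.{u}.IsTree :=
  ⟨fun _ _ h => h.elim, .of_subsingleton (V := PUnit)⟩

/-- The disjoint union of `S` and `T` with an additional arc from `s` to `t`. -/
def join (S T : FinDigraph.{u}) (s : S.V) (t : T.V) : FinDigraph.{u} where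
  V := S.V ⊕ T.V
  graph := { Adj := fun a b => Sum.LiftRel S.Adj T.Adj a b ∨ a = .inl s ∧ b = .inr t }

open SimpleGraph in
theorem isTree_sum_sup_edge {V W : Type*} [Finite V] [Finite W] {G : SimpleGraph V}
    {H : SimpleGraph W} (hG : G.IsTree) (hH : H.IsTree) (v : V) (w : W) :
    ((G ⊕g H) ⊔ edge (.inl v) (.inr w)).IsTree := by
  rw [isTree_iff_connected_and_card] at hG hH ⊢
  refine ⟨hG.1.sum_sup_edge hH.1, ?_⟩
  have hedges : ((G ⊕g H) ⊔ edge (.inl v) (.inr w)).edgeSet =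
      insert s(.inl v, .inr w) (G ⊕g H).edgeSet := by
    rw [edgeSet_sup, edgeSet_edge_of_ne (by simp), Set.union_comm, Set.singleton_union]
  have hcard : Nat.card (G ⊕g H).edgeSet = Nat.card G.edgeSet + Nat.card H.edgeSet := by
    rw [Nat.card_congr edgeSetSumEquiv, Nat.card_sum]
  rw [hedges, Nat.card_coe_set_eq, Set.ncard_insert_of_notMem (by simp), ← Nat.card_coe_set_eq,
    hcard, Nat.card_sum]
  omega

theorem join_toSimpleGraphInclusive (s : S.V) (t : T.V) :
    (S.join T s t).graph.toSimpleGraphInclusive =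
      ((S.graph.toSimpleGraphInclusive ⊕g T.graph.toSimpleGraphInclusive) ⊔
        SimpleGraph.edge (.inl s) (.inr t) : SimpleGraph (S.V ⊕ T.V)) := by
  ext (a | a) (b | b) <;>
    simp [join, Digraph.toSimpleGraphInclusive, SimpleGraph.edge_adj, and_comm]

theorem IsTree.join (hS : S.IsTree) (hT : T.IsTree) (s : S.V) (t : T.V) :
    (S.join T s t).IsTree := by
  refine ⟨?_, join_toSimpleGraphInclusive s t ▸ isTree_sum_sup_edge hS.2 hT.2 s t⟩
  rintro (a | a) (b | b)
  · simpa [FinDigraph.join, Adj] using hS.1 a b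
  · simp [FinDigraph.join, Adj]
  · simp [FinDigraph.join, Adj]
  · simpa [FinDigraph.join, Adj] using hT.1 a b

/-! ### Tree obstructions to arc consistency -/

/-- Some tree over `X` forces the image in `H` of a vertex over `x` to belong to `A`. -/
def Forces (X H : FinDigraph.{u}) (x : X.V) (A : Set H.V) : Prop :=
  ∃ (T : FinDigraph.{u}) (r : T.V) (φ : Hom T X), T.IsTree ∧ φ r = x ∧ ∀ ψ : Hom T H, ψ r ∈ A

theorem forces_univ (X H : FinDigraph.{u}) (x : X.V) : X.Forces H x Set.univ :=
  ⟨point, ⟨⟩, ⟨fun _ => x, fun h => h.elim⟩, isTree_point, rfl, fun _ => trivial⟩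

theorem Forces.nonempty {x : X.V} {A : Set H.V} (hA : X.Forces H x A)
    (h : ∀ T : FinDigraph.{u}, T.IsTree → T.MapsTo X → T.MapsTo H) : A.Nonempty := by
  obtain ⟨T, r, φ, hT, -, hr⟩ := hA
  obtain ⟨ψ⟩ := h T hT ⟨φ⟩
  exact ⟨ψ r, hr ψ⟩

theorem Forces.exists_join {x y : X.V} {A B : Set H.V} (hA : X.Forces H x A)
    (hB : X.Forces H y B) (hxy : X.Adj x y) :
    ∃ (T : FinDigraph.{u}) (s t : T.V) (φ : Hom T X), T.IsTree ∧ φ s = x ∧ φ t = y ∧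
      ∀ ψ : Hom T H, ψ s ∈ A ∧ ψ t ∈ B ∧ H.Adj (ψ s) (ψ t) := by
  obtain ⟨S, s, φ, hS, rfl, hsA⟩ := hA
  obtain ⟨T, t, χ, hT, rfl, htB⟩ := hB
  let φχ : Hom (S.join T s t) X := ⟨Sum.elim φ χ, by
    rintro _ _ ((h | h) | ⟨rfl, rfl⟩)
    exacts [φ.map_rel h, χ.map_rel h, hxy]⟩
  refine ⟨S.join T s t, .inl s, .inr t, φχ, hS.join hT s t, rfl, rfl, fun ψ => ⟨?_, ?_, ?_⟩⟩
  · exact hsA (ψ.comp ⟨Sum.inl, fun h => .inl (.inl h)⟩)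
  · exact htB (ψ.comp ⟨Sum.inr, fun h => .inl (.inr h)⟩)
  · exact ψ.map_rel (.inr ⟨rfl, rfl⟩)

/-- The minimal forced sets are arc-consistent lists. -/
theorem arcConsistent_of_forall_isTree
    (h : ∀ T : FinDigraph.{u}, T.IsTree → T.MapsTo X → T.MapsTo H) : X.ArcConsistent H := by
  have hmin : ∀ x, ∃ A, Minimal (X.Forces H x) A := fun x => by
    obtain ⟨A, -, hA⟩ :=
      (Set.toFinite {A | X.Forces H x A}).exists_le_minimal (forces_univ X H x)
    exact ⟨A, hA⟩
  choose L hL using hmin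
  refine ⟨L, fun x => (hL x).prop.nonempty h, fun {x y} hxy a ha => ?_, fun {x y} hxy b hb => ?_⟩
  all_goals obtain ⟨T, s, t, φ, hT, hs, ht, hst⟩ := (hL x).prop.exists_join (hL y).prop hxy
  · have hforces : X.Forces H x {a ∈ L x | ∃ b ∈ L y, H.Adj a b} :=
      ⟨T, s, φ, hT, hs, fun ψ => ⟨(hst ψ).1, ψ t, (hst ψ).2⟩⟩
    exact ((hL x).le_of_le hforces (Set.sep_subset _ _) ha).2
  · have hforces : X.Forces H y {b ∈ L y | ∃ a ∈ L x, H.Adj a b} :=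
      ⟨T, t, φ, hT, ht, fun ψ => ⟨(hst ψ).2.1, ψ s, (hst ψ).1, (hst ψ).2.2⟩⟩
    exact ((hL y).le_of_le hforces (Set.sep_subset _ _) hb).2

/-! ### Bounded-height tree duality -/

/-- The product of two digraphs. -/
def binaryProd (G H : FinDigraph.{u}) : FinDigraph.{u} where
  V := G.V × H.V
  graph := { Adj := fun p q => G.Adj p.1 q.1 ∧ H.Adj p.2 q.2 }

theorem mapsTo_binaryProd_iff : T.MapsTo (G.binaryProd H) ↔ T.MapsTo G ∧ T.MapsTo H :=
  ⟨fun ⟨f⟩ => ⟨⟨⟨fun t => (f t).1, fun h => (f.map_rel h).1⟩⟩,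
      ⟨⟨fun t => (f t).2, fun h => (f.map_rel h).2⟩⟩⟩,
    fun ⟨⟨f⟩, ⟨g⟩⟩ => ⟨⟨fun t => (f t, g t), fun h => ⟨f.map_rel h, g.map_rel h⟩⟩⟩⟩

/-- The trees that map to `G` and have algebraic height at most `m` are those that map to the
product of `G` with the path `dirPath m`. -/
theorem hasBoundedHeightTreeDuality_iff :
    H.HasBoundedHeightTreeDuality ↔
      ∃ m : ℕ, ∀ G : FinDigraph.{u}, (G.binaryProd (dirPath m)).ArcConsistent H → G.MapsTo H := by
  constructor
  · rintro ⟨m, F, hF, hFH⟩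
    refine ⟨m, fun G hG => (hFH G).2 fun T hT hTG => ?_⟩
    have hTX := mapsTo_binaryProd_iff.2 ⟨hTG, algHeight_le_iff.1 (hF T hT).2⟩
    exact (hFH H).1 (.refl H) T hT ((hF T hT).1.mapsTo_of_arcConsistent (hG.of_mapsTo hTX))
  · rintro ⟨m, hm⟩
    refine ⟨m, {T | (T.IsTree ∧ T.algHeight ≤ m) ∧ ¬ T.MapsTo H}, fun T hT => hT.1, fun G => ?_⟩
    refine ⟨fun hG T hT hTG => hT.2 (hTG.trans hG), fun hG => hm G ?_⟩
    refine arcConsistent_of_forall_isTree fun T hT hTX => ?_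
    obtain ⟨hTG, hTm⟩ := mapsTo_binaryProd_iff.1 hTX
    by_contra hTH
    exact hG T ⟨⟨hT, algHeight_le_iff.2 hTm⟩, hTH⟩ hTG

/-- The left adjoint of the arc graph construction: each vertex `u` becomes an arc from
`(u, false)` to `(u, true)`, and `(u, true)` is identified with `(v, false)` for each arc
`(u, v)`. -/
def arcGraphLeftAdjoint (G : FinDigraph.{u}) : FinDigraph.{u} where
  V := Quot fun p q : G.V × Bool => G.Adj p.1 q.1 ∧ p.2 = true ∧ q.2 = false
  graph := { Adj := fun c d => ∃ u, c = Quot.mk _ (u, false) ∧ d = Quot.mk _ (u, true) }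

theorem MapsTo.arcGraph_of_leftAdjoint (h : G.arcGraphLeftAdjoint.MapsTo H) :
    G.MapsTo H.arcGraph := by
  obtain ⟨f⟩ := h
  exact ⟨fun u => ⟨(f (Quot.mk _ (u, false)), f (Quot.mk _ (u, true))), f.map_rel ⟨u, rfl, rfl⟩⟩,
    fun h => congrArg f (Quot.sound ⟨h, rfl, rfl⟩)⟩

theorem arcGraphLeftAdjoint_binaryProd_mapsTo (G : FinDigraph.{u}) (m : ℕ) :
    (G.arcGraphLeftAdjoint.binaryProd (dirPath m)).MapsTo
      (G.binaryProd (dirPath (m + 1))).arcGraphLeftAdjoint := by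
  let Q := (G.binaryProd (dirPath (m + 1))).arcGraphLeftAdjoint
  -- the copy of `u` at level `i + 1` starts at height `i`, the one at level `i` ends there
  let f (i : Fin (m + 1)) : G.arcGraphLeftAdjoint.V → Q.V :=
    Quot.lift (fun p => Quot.mk _ ((p.1, ⟨if p.2 then i.castSucc else i.succ⟩), p.2)) (by
      rintro ⟨u, _⟩ ⟨v, _⟩ ⟨huv, rfl, rfl⟩
      exact Quot.sound ⟨⟨huv, rfl⟩, rfl, rfl⟩)
  refine ⟨fun p => f p.2.down p.1, ?_⟩
  rintro ⟨_, ⟨i⟩⟩ ⟨_, ⟨j⟩⟩ ⟨⟨u, rfl, rfl⟩, hij⟩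
  have hij : j.castSucc = i.succ := Fin.ext hij
  exact ⟨(u, ⟨i.succ⟩), rfl, hij ▸ rfl⟩

theorem IsArcConsistent.image_snd_eq_image_fst {L : G.V → Set H.arcGraph.V}
    (hL : IsArcConsistent G.Adj H.arcGraph.Adj L) {x y : G.V} (hxy : G.Adj x y) :
    (fun a => a.1.2) '' L x = (fun a => a.1.1) '' L y := by
  refine subset_antisymm ?_ ?_
  · rintro _ ⟨a, ha, rfl⟩
    obtain ⟨b, hb, hab⟩ := hL.forward hxy a ha
    exact ⟨b, hb, hab.symm⟩
  · rintro _ ⟨b, hb, rfl⟩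
    obtain ⟨a, ha, hab⟩ := hL.backward hxy b hb
    exact ⟨a, ha, hab⟩

theorem ArcConsistent.leftAdjoint (h : G.ArcConsistent H.arcGraph) :
    G.arcGraphLeftAdjoint.ArcConsistent H := by
  obtain ⟨L, hL⟩ := h
  let L' : G.arcGraphLeftAdjoint.V → Set H.V :=
    Quot.lift (fun p => (fun a => if p.2 then a.1.2 else a.1.1) '' L p.1) (by
      rintro ⟨u, _⟩ ⟨v, _⟩ ⟨huv, rfl, rfl⟩
      exact hL.image_snd_eq_image_fst huv)
  refine ⟨L', ?_, ?_, ?_⟩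
  · rintro ⟨u, _⟩
    exact (hL.nonempty u).image _
  · rintro _ _ ⟨u, rfl, rfl⟩ _ ⟨a, ha, rfl⟩
    exact ⟨a.1.2, ⟨a, ha, rfl⟩, a.2⟩
  · rintro _ _ ⟨u, rfl, rfl⟩ _ ⟨a, ha, rfl⟩
    exact ⟨a.1.1, ⟨a, ha, rfl⟩, a.2⟩

namespace HasBoundedHeightTreeDuality

theorem of_homEquiv (he : H.HomEquiv H') (h : H.HasBoundedHeightTreeDuality) :
    H'.HasBoundedHeightTreeDuality := by
  obtain ⟨m, F, hF, hFH⟩ := h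
  exact ⟨m, F, hF, fun G => ⟨fun hG => (hFH G).1 (hG.trans he.2),
    fun hG => ((hFH G).2 hG).trans he.1⟩⟩

theorem prod {k : ℕ} {H : Fin k → FinDigraph.{u}} (h : ∀ i, (H i).HasBoundedHeightTreeDuality) :
    (FinDigraph.prod H).HasBoundedHeightTreeDuality := by
  choose m F hF hFH using h
  refine ⟨Finset.univ.sup m, ⋃ i, F i, fun T hT => ?_, fun G => ?_⟩
  · obtain ⟨i, hi⟩ := Set.mem_iUnion.1 hT
    have hm : m i ≤ Finset.univ.sup m := Finset.le_sup (Finset.mem_univ i)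
    exact ⟨(hF i T hi).1, (hF i T hi).2.trans (Nat.cast_le.2 hm)⟩
  · simp only [mapsTo_prod_iff, hFH _ G, Set.mem_iUnion, forall_exists_index]
    exact forall_comm

theorem arcGraph (h : H.HasBoundedHeightTreeDuality) :
    H.arcGraph.HasBoundedHeightTreeDuality := by
  rw [hasBoundedHeightTreeDuality_iff] at h ⊢
  obtain ⟨m, hm⟩ := h
  refine ⟨m + 1, fun G hG => .arcGraph_of_leftAdjoint (hm _ ?_)⟩
  exact hG.leftAdjoint.of_mapsTo (arcGraphLeftAdjoint_binaryProd_mapsTo G m)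

end HasBoundedHeightTreeDuality

theorem IsDual.hasBoundedHeightTreeDuality (hT : T.IsTree) (hD : IsDual T D) :
    D.HasBoundedHeightTreeDuality := by
  obtain ⟨m, hm⟩ := hT.exists_mapsTo_dirPath
  refine ⟨m, {T}, ?_, fun G => ?_⟩
  · rintro _ rfl
    exact ⟨hT, algHeight_le_iff.2 hm⟩
  · simpa only [Set.mem_singleton_iff, forall_eq] using hD G

theorem DeltaPiC.hasBoundedHeightTreeDuality (h : H.DeltaPiC) : H.HasBoundedHeightTreeDuality := by
  induction h with
  | dual hT hD => exact hD.hasBoundedHeightTreeDuality hT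
  | arcGraph _ ih => exact ih.arcGraph
  | prod _ ih => exact .prod ih
  | homEquiv _ he ih => exact ih.of_homEquiv he

end FinDigraph

theorem proposition3p1 :
    -- (i)
    (∀ H : FinDigraph.{u}, H.DeltaPiC → H.IsCore → H.HasNearUnanimity) ∧
    -- (ii)
    (∀ H : FinDigraph.{u}, H.DeltaPiC → H.HasBoundedHeightTreeDuality) ∧
    -- (iii) near-unanimity functions are preserved by cores, finite products and arc graphs
    ((∀ (H : FinDigraph.{u}) (C : H.Subgraph), C.IsCoreOf → H.HasNearUnanimity →
        C.toFinDigraph.HasNearUnanimity) ∧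
      (∀ (k : ℕ) (H : Fin k → FinDigraph.{u}), (∀ i, (H i).HasNearUnanimity) →
        (FinDigraph.prod H).HasNearUnanimity) ∧
      (∀ H : FinDigraph.{u}, H.HasNearUnanimity → H.arcGraph.HasNearUnanimity)) ∧
    -- (iv) bounded-height tree duality is preserved by cores, finite products and arc graphs
    ((∀ (H : FinDigraph.{u}) (C : H.Subgraph), C.IsCoreOf → H.HasBoundedHeightTreeDuality →
        C.toFinDigraph.HasBoundedHeightTreeDuality) ∧
      (∀ (k : ℕ) (H : Fin k → FinDigraph.{u}), (∀ i, (H i).HasBoundedHeightTreeDuality) →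
        (FinDigraph.prod H).HasBoundedHeightTreeDuality) ∧
      (∀ H : FinDigraph.{u}, H.HasBoundedHeightTreeDuality →
        H.arcGraph.HasBoundedHeightTreeDuality)) := by
  open FinDigraph in
  refine ⟨fun H hH hcore => ?_, fun _ => DeltaPiC.hasBoundedHeightTreeDuality,
    ⟨fun _ _ => HasNearUnanimity.core, fun _ _ => HasNearUnanimity.prod,
      fun _ => HasNearUnanimity.arcGraph⟩,
    fun _ _ hC => HasBoundedHeightTreeDuality.of_homEquiv hC.homEquiv,
    fun _ _ => HasBoundedHeightTreeDuality.prod, fun _ => HasBoundedHeightTreeDuality.arcGraph⟩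
  obtain ⟨e, he⟩ := hH.hasQuasiNearUnanimity
  exact he.hasNearUnanimity_of_surjective (hcore.surjective e)
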